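/- Let $E/\mathbb{Q}$ be an elliptic curve, given by a minimal Weierstrass equation $W$ over $\mathbb{Z}$ (an integral equation for $E$ whose discriminant has the smallest possible absolute value), and let $L(E/\mathbb{Q},s)=\sum_{m\ge 1} a_m m^{-s}$ be its $L$-series. The curve $E$ has good reduction at a prime $p$ if $W$ modulo $p$ is nonsingular. If $E$ has good reduction at every prime dividing a positive integer $m$, then $W$ defines an elliptic curve (a group scheme) over $\mathbb{Z}/m\mathbb{Z}$, and $E(\mathbb{Z}/m\mathbb{Z})$ denotes its group of $\mathbb{Z}/m\mathbb{Z}$-valued points. The exponent of a finite group is the least common multiple of the orders of its elements. Let $n$ be a positive integer. - $n$ is an *elliptic Carmichael number for $E$* if $n$ has at least two distinct prime factors, $E$ has good reduction at every prime dividing $n$, and $(n+1-a_n)P=0$ for every $P\in E(\mathbb{Z}/n\mathbb{Z})$. - $n$ is an *elliptic Korselt number for $E$ of Type II* if $n$ has at least two distinct prime factors and, for every prime $p$ dividing $n$, $E$ has good reduction at $p$ and the exponent of the group $E(\mathbb{Z}/p^{\operatorname{ord}_p(n)}\mathbb{Z})$ divides $n+1-a_n$. **Proposition (Elliptic Korselt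 Criterion II).** Let $n>2$ be an odd integer and let $E/\mathbb{Q}$ be an elliptic curve. Then $n$ is an elliptic Carmichael number for $E$ if and only if $n$ is an elliptic Korselt number for $E$ of Type II. -/

import Mathlib

namespace EllKorselt

open WeierstrassCurve WeierstrassCurve.Projective

universe u

/-! ### A second addition law

Mathlib's `addXYZ` computes `P + Q` except where `P = Q`.  The next three forms, again of bidegree
`(2, 2)` in `P` and `Q`, also represent `P + Q`, and do not all vanish where `P = Q`. -/

/-- The `X`-coordinate of the second addition law. -/
def altX {R : Type u} [CommRing R] (W : WeierstrassCurve R) (P Q : Fin 3 → R) : R :=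
  -W.a₃ * W.b₈ * P 2 ^ 2 * Q 2 ^ 2 - W.b₈ * P 2 ^ 2 * Q 1 * Q 2
    - W.a₃ * (W.a₃ ^ 2 + 6 * W.a₆) * P 2 ^ 2 * Q 0 * Q 2
    - 3 * W.a₆ * P 2 ^ 2 * Q 0 * Q 1 - W.a₃ * W.a₄ * P 2 ^ 2 * Q 0 ^ 2
    - W.b₈ * P 1 * P 2 * Q 2 ^ 2 - 6 * W.a₆ * P 1 * P 2 * Q 0 * Q 2
    + 2 * W.a₃ * P 1 * P 2 * Q 0 * Q 1 + (W.a₁ * W.a₃ - W.a₄) * P 1 * P 2 * Q 0 ^ 2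
    + W.a₃ * P 1 ^ 2 * Q 0 * Q 2 + P 1 ^ 2 * Q 0 * Q 1 + W.a₁ * P 1 ^ 2 * Q 0 ^ 2
    - (W.a₁ * W.b₈ + W.a₃ ^ 3 + 3 * W.a₃ * W.a₆) * P 0 * P 2 * Q 2 ^ 2
    - (2 * W.a₃ ^ 2 + 6 * W.a₆) * P 0 * P 2 * Q 1 * Q 2
    - (2 * W.a₁ * W.a₃ ^ 2 + 2 * W.a₃ * W.a₄ + 6 * W.a₁ * W.a₆) * P 0 * P 2 * Q 0 * Q 2
    - 2 * W.a₄ * P 0 * P 2 * Q 0 * Q 1 - (W.a₂ * W.a₃ + W.a₁ * W.a₄) * P 0 * P 2 * Q 0 ^ 2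
    - (W.a₃ ^ 2 + 3 * W.a₆) * P 0 * P 1 * Q 2 ^ 2 + P 0 * P 1 * Q 1 ^ 2
    - 2 * W.a₄ * P 0 * P 1 * Q 0 * Q 2 + 2 * W.a₁ * P 0 * P 1 * Q 0 * Q 1
    + (W.a₁ ^ 2 - W.a₂) * P 0 * P 1 * Q 0 ^ 2
    - W.a₁ * (W.a₃ ^ 2 + 3 * W.a₆) * P 0 ^ 2 * Q 2 ^ 2
    - (W.a₁ * W.a₃ + W.a₄) * P 0 ^ 2 * Q 1 * Q 2
    - (W.a₁ ^ 2 * W.a₃ + 2 * W.a₁ * W.a₄) * P 0 ^ 2 * Q 0 * Q 2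
    - W.a₂ * P 0 ^ 2 * Q 0 * Q 1 - W.a₁ * W.a₂ * P 0 ^ 2 * Q 0 ^ 2

/-- The `Y`-coordinate of the second addition law. -/
def altY {R : Type u} [CommRing R] (W : WeierstrassCurve R) (P Q : Fin 3 → R) : R :=
  ((W.a₁ * W.a₃ + W.a₄) * W.b₈ - (W.a₃ ^ 2 + 3 * W.a₆) ^ 2) * P 2 ^ 2 * Q 2 ^ 2
    + (W.a₂ * W.b₈ - 2 * W.a₃ ^ 2 * W.a₄ + 3 * W.a₁ * W.a₃ * W.a₆ - 3 * W.a₄ * W.a₆)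
      * P 2 ^ 2 * Q 0 * Q 2
    + (3 * W.a₂ * W.a₆ - W.a₄ ^ 2) * P 2 ^ 2 * Q 0 ^ 2
    + (W.a₁ * W.b₈ - W.a₃ ^ 3 - 3 * W.a₃ * W.a₆) * P 1 * P 2 * Q 2 ^ 2
    + (6 * W.a₁ * W.a₆ - 2 * W.a₃ * W.a₄) * P 1 * P 2 * Q 0 * Q 2
    + (W.a₁ * W.a₄ - W.a₂ * W.a₃) * P 1 * P 2 * Q 0 ^ 2
    + W.a₃ * P 1 ^ 2 * Q 1 * Q 2 + P 1 ^ 2 * Q 1 ^ 2 + W.a₁ * P 1 ^ 2 * Q 0 * Q 1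
    + ((W.a₁ ^ 2 + W.a₂) * W.b₈ - (W.a₁ * W.a₃ + W.a₄) * (W.a₃ ^ 2 + 3 * W.a₆))
      * P 0 * P 2 * Q 2 ^ 2
    + (2 * W.a₂ * W.a₃ ^ 2 - 4 * W.a₁ * W.a₃ * W.a₄ - 4 * W.a₄ ^ 2 + 6 * W.a₁ ^ 2 * W.a₆
      + 12 * W.a₂ * W.a₆) * P 0 * P 2 * Q 0 * Q 2
    + (9 * W.a₆ - W.a₂ * W.a₄) * P 0 * P 2 * Q 0 ^ 2
    + (3 * W.a₁ * W.a₆ - W.a₃ * W.a₄) * P 0 * P 1 * Q 2 ^ 2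
    + 2 * (W.a₁ * W.a₄ - W.a₂ * W.a₃) * P 0 * P 1 * Q 0 * Q 2
    + (W.a₁ * W.a₂ - 3 * W.a₃) * P 0 * P 1 * Q 0 ^ 2
    + (W.a₂ * W.a₃ ^ 2 - 2 * W.a₁ * W.a₃ * W.a₄ - W.a₄ ^ 2 + 3 * W.a₁ ^ 2 * W.a₆
      + 3 * W.a₂ * W.a₆) * P 0 ^ 2 * Q 2 ^ 2
    + (3 * W.a₃ ^ 2 - 2 * W.a₁ * W.a₂ * W.a₃ + W.a₁ ^ 2 * W.a₄ - W.a₂ * W.a₄ + 9 * W.a₆)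
      * P 0 ^ 2 * Q 0 * Q 2
    + (3 * W.a₄ - W.a₂ ^ 2) * P 0 ^ 2 * Q 0 ^ 2

/-- The `Z`-coordinate of the second addition law. -/
def altZ {R : Type u} [CommRing R] (W : WeierstrassCurve R) (P Q : Fin 3 → R) : R :=
  -W.toProjective.addY P (W.toProjective.neg Q)

/-- The second addition law. -/
def altXYZ {R : Type u} [CommRing R] (W : WeierstrassCurve R) (P Q : Fin 3 → R) : Fin 3 → R :=
  ![altX W P Q, altY W P Q, altZ W P Q]

/-- Two vectors are parallel if all `2 × 2` minors of the matrix that they form vanish. -/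
def Parallel {R : Type u} [CommRing R] (v w : Fin 3 → R) : Prop :=
  ∀ i j, v i * w j = v j * w i

theorem parallel_iff {R : Type u} [CommRing R] {v w : Fin 3 → R} : Parallel v w ↔
    v 0 * w 1 = v 1 * w 0 ∧ v 0 * w 2 = v 2 * w 0 ∧ v 1 * w 2 = v 2 * w 1 := by
  refine ⟨fun h => ⟨h 0 1, h 0 2, h 1 2⟩, fun ⟨h₁, h₂, h₃⟩ i j => ?_⟩
  fin_cases i <;> fin_cases j <;>
    first | rfl | assumption | (symm; assumption)

theorem Parallel.smul {R : Type u} [CommRing R] {v w : Fin 3 → R} (h : Parallel v w) (a b : R) :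
    Parallel (a • v) (b • w) := by
  intro i j
  simp only [Pi.smul_apply, smul_eq_mul]
  linear_combination a * b * h i j

theorem Parallel.symm {R : Type u} [CommRing R] {v w : Fin 3 → R} (h : Parallel v w) :
    Parallel w v := fun i j => by linear_combination h j i

theorem parallel_refl {R : Type u} [CommRing R] (v : Fin 3 → R) : Parallel v v :=
  fun _ _ => mul_comm _ _

theorem Parallel.map {R S : Type*} [CommRing R] [CommRing S] (f : R →+* S) {v w : Fin 3 → R}
    (h : Parallel v w) : Parallel (f ∘ v) (f ∘ w) := fun i j => by
  simp only [Function.comp_apply, ← map_mul, h i j]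

theorem altXYZ_smul {R : Type u} [CommRing R] (W : WeierstrassCurve R) (P Q : Fin 3 → R) (a b : R) :
    altXYZ W (a • P) (b • Q) = (a * b) ^ 2 • altXYZ W P Q := by
  ext i
  fin_cases i
  · simp [altXYZ, altX]; ring
  · simp [altXYZ, altY]; ring
  · simp only [altXYZ, altZ, Projective.neg_smul, addY_smul, Pi.smul_apply, smul_eq_mul]
    simp

theorem altXYZ_map {R S : Type*} [CommRing R] [CommRing S] (f : R →+* S) (W : WeierstrassCurve R)
    (P Q : Fin 3 → R) : altXYZ (W.map f) (f ∘ P) (f ∘ Q) = f ∘ altXYZ W P Q := by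
  ext i
  fin_cases i
  · simp [altXYZ, altX, map_ofNat]
  · simp [altXYZ, altY, map_ofNat]
  · simp [altXYZ, altZ, Projective.map_neg, map_addY]

section Field

variable {F : Type u} [Field F] (W : WeierstrassCurve F)

theorem altX_cross {x₁ y₁ x₂ y₂ : F} (h₁ : W.toProjective.Equation ![x₁, y₁, 1])
    (h₂ : W.toProjective.Equation ![x₂, y₂, 1]) (hx : x₁ - x₂ ≠ 0) :
    altX W ![x₁, y₁, 1] ![x₂, y₂, 1] * (x₁ - x₂) ^ 2 =
      ((y₁ - y₂) ^ 2 + W.a₁ * (y₁ - y₂) * (x₁ - x₂) - (W.a₂ + x₁ + x₂) * (x₁ - x₂) ^ 2) *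
        altZ W ![x₁, y₁, 1] ![x₂, y₂, 1] := by
  rw [equation_iff] at h₁ h₂
  obtain ⟨a₁, a₂, a₃, a₄, a₆⟩ := W
  simp only [fin3_def_ext] at h₁ h₂
  have h6 : a₆ = y₁ ^ 2 + a₁ * x₁ * y₁ + a₃ * y₁ - x₁ ^ 3 - a₂ * x₁ ^ 2 - a₄ * x₁ := by
    linear_combination -h₁
  have h4 : a₄ = ((y₁ ^ 2 + a₁ * x₁ * y₁ + a₃ * y₁ - x₁ ^ 3 - a₂ * x₁ ^ 2) -
      (y₂ ^ 2 + a₁ * x₂ * y₂ + a₃ * y₂ - x₂ ^ 3 - a₂ * x₂ ^ 2)) / (x₁ - x₂) := by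
    rw [eq_div_iff hx]; linear_combination h₂ - h₁
  clear h₁ h₂
  simp only [altX, altZ, addY, addX, negAddY, addZ, neg, negY, fin3_def_ext, b₈]
  subst h6
  subst h4
  field_simp
  ring

theorem altY_cross {x₁ y₁ x₂ y₂ : F} (h₁ : W.toProjective.Equation ![x₁, y₁, 1])
    (h₂ : W.toProjective.Equation ![x₂, y₂, 1]) (hx : x₁ - x₂ ≠ 0) :
    altY W ![x₁, y₁, 1] ![x₂, y₂, 1] * (x₁ - x₂) ^ 3 =
      (-((y₁ - y₂) * ((y₁ - y₂) ^ 2 + W.a₁ * (y₁ - y₂) * (x₁ - x₂)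
          - (W.a₂ + x₁ + x₂) * (x₁ - x₂) ^ 2 - x₁ * (x₁ - x₂) ^ 2) + y₁ * (x₁ - x₂) ^ 3)
        - W.a₁ * ((y₁ - y₂) ^ 2 + W.a₁ * (y₁ - y₂) * (x₁ - x₂)
          - (W.a₂ + x₁ + x₂) * (x₁ - x₂) ^ 2) * (x₁ - x₂) - W.a₃ * (x₁ - x₂) ^ 3) *
        altZ W ![x₁, y₁, 1] ![x₂, y₂, 1] := by
  rw [equation_iff] at h₁ h₂
  obtain ⟨a₁, a₂, a₃, a₄, a₆⟩ := W
  simp only [fin3_def_ext] at h₁ h₂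
  have h6 : a₆ = y₁ ^ 2 + a₁ * x₁ * y₁ + a₃ * y₁ - x₁ ^ 3 - a₂ * x₁ ^ 2 - a₄ * x₁ := by
    linear_combination -h₁
  have h4 : a₄ = ((y₁ ^ 2 + a₁ * x₁ * y₁ + a₃ * y₁ - x₁ ^ 3 - a₂ * x₁ ^ 2) -
      (y₂ ^ 2 + a₁ * x₂ * y₂ + a₃ * y₂ - x₂ ^ 3 - a₂ * x₂ ^ 2)) / (x₁ - x₂) := by
    rw [eq_div_iff hx]; linear_combination h₂ - h₁
  clear h₁ h₂
  simp only [altY, altZ, addY, addX, negAddY, addZ, neg, negY, fin3_def_ext, b₈]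
  subst h6
  subst h4
  field_simp
  ring

theorem altXYZ_self_affine {x y : F} (h : W.toProjective.Equation ![x, y, 1]) :
    altXYZ W ![x, y, 1] ![x, y, 1] = W.toProjective.dblXYZ ![x, y, 1] := by
  rw [equation_iff] at h
  obtain ⟨a₁, a₂, a₃, a₄, a₆⟩ := W
  simp only [fin3_def_ext] at h
  have h6 : a₆ = y ^ 2 + a₁ * x * y + a₃ * y - x ^ 3 - a₂ * x ^ 2 - a₄ * x := by
    linear_combination -h
  clear h
  simp only [altXYZ, dblXYZ, altX, altY, altZ, addY, addX, negAddY, addZ, neg, negY, dblX, dblY,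
    negDblY, dblZ, fin3_def_ext, b₈]
  subst h6
  congr 1
  · ring
  congr 1
  · ring
  congr 1
  ring

theorem altX_neg_affine {x y : F} (h : W.toProjective.Equation ![x, y, 1]) :
    altX W ![x, y, 1] ![x, -y - W.a₁ * x - W.a₃, 1] = 0 := by
  rw [equation_iff] at h
  obtain ⟨a₁, a₂, a₃, a₄, a₆⟩ := W
  simp only [fin3_def_ext] at h
  have h6 : a₆ = y ^ 2 + a₁ * x * y + a₃ * y - x ^ 3 - a₂ * x ^ 2 - a₄ * x := by
    linear_combination -h
  clear h
  simp only [altX, fin3_def_ext, b₈]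
  subst h6
  ring

theorem altZ_neg_affine {x y : F} :
    altZ W ![x, y, 1] ![x, -y - W.a₁ * x - W.a₃, 1] = 0 := by
  simp only [altZ, addY, addX, negAddY, addZ, neg, negY, fin3_def_ext]
  ring

end Field

section Field

variable {F : Type u} [Field F] (W : WeierstrassCurve F)

theorem eq_smul_affine {P : Fin 3 → F} (hz : P 2 ≠ 0) : P = P 2 • ![P 0 / P 2, P 1 / P 2, 1] := by
  ext i
  fin_cases i <;> simp [mul_div_cancel₀, hz]

theorem equation_affine {P : Fin 3 → F} (hP : W.toProjective.Equation P) (hz : P 2 ≠ 0) :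
    W.toProjective.Equation ![P 0 / P 2, P 1 / P 2, 1] := by
  rw [eq_smul_affine hz] at hP
  exact (equation_smul _ hz.isUnit).mp hP

theorem altXYZ_self {P : Fin 3 → F} (hP : W.toProjective.Equation P) :
    altXYZ W P P = W.toProjective.dblXYZ P := by
  by_cases hz : P 2 = 0
  · have hx : P 0 = 0 := X_eq_zero_of_Z_eq_zero hP hz
    rw [dblXYZ_of_Z_eq_zero hP hz]
    ext i
    fin_cases i <;>
      simp [altXYZ, altX, altY, altZ, addY, addX, negAddY, addZ, neg, negY, hx, hz]
    ring
  · have h := altXYZ_self_affine W (equation_affine W hP hz)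
    rw [eq_smul_affine hz, altXYZ_smul, dblXYZ_smul, h]
    ring_nf

theorem parallel_altXYZ_affine {x₁ y₁ x₂ y₂ : F} (h₁ : W.toProjective.Equation ![x₁, y₁, 1])
    (h₂ : W.toProjective.Equation ![x₂, y₂, 1]) (hne : ¬ (x₁ = x₂ ∧ y₁ = y₂)) :
    Parallel (altXYZ W ![x₁, y₁, 1] ![x₂, y₂, 1])
      (W.toProjective.addXYZ ![x₁, y₁, 1] ![x₂, y₂, 1]) := by
  by_cases hx : x₁ = x₂
  · subst hx
    have hy : y₂ = -y₁ - W.a₁ * x₁ - W.a₃ := by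
      have hy' : y₁ - y₂ ≠ 0 := fun h => hne ⟨rfl, sub_eq_zero.mp h⟩
      rw [equation_iff] at h₁ h₂
      simp only [fin3_def_ext] at h₁ h₂
      apply mul_left_cancel₀ hy'
      linear_combination h₁ - h₂
    rw [addXYZ_of_X_eq h₁ h₂ (by simp) (by simp) (by simp), parallel_iff]
    have hX := altX_neg_affine W h₁
    have hZ := altZ_neg_affine W (x := x₁) (y := y₁)
    rw [← hy] at hX hZ
    simp [altXYZ, hX, hZ]
  · have hd : x₁ - x₂ ≠ 0 := sub_ne_zero.mpr hx
    have eX := altX_cross W h₁ h₂ hd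
    have eY := altY_cross W h₁ h₂ hd
    have fX := addX_eq' h₁ h₂
    have fY := negAddY_eq' h₁ h₂
    have fZ := addZ_eq' h₁ h₂
    simp only [fin3_def_ext, mul_one, one_pow] at fX fY fZ
    have gY : W.toProjective.addY ![x₁, y₁, 1] ![x₂, y₂, 1] =
        -W.toProjective.negAddY ![x₁, y₁, 1] ![x₂, y₂, 1]
          - W.a₁ * W.toProjective.addX ![x₁, y₁, 1] ![x₂, y₂, 1]
          - W.a₃ * W.toProjective.addZ ![x₁, y₁, 1] ![x₂, y₂, 1] := rfl
    have kX : altX W ![x₁, y₁, 1] ![x₂, y₂, 1] * W.toProjective.addZ ![x₁, y₁, 1] ![x₂, y₂, 1] =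
        altZ W ![x₁, y₁, 1] ![x₂, y₂, 1] * W.toProjective.addX ![x₁, y₁, 1] ![x₂, y₂, 1] := by
      rw [fX, fZ]
      linear_combination (x₁ - x₂) * eX
    have kY : altY W ![x₁, y₁, 1] ![x₂, y₂, 1] * W.toProjective.addZ ![x₁, y₁, 1] ![x₂, y₂, 1] =
        altZ W ![x₁, y₁, 1] ![x₂, y₂, 1] * W.toProjective.addY ![x₁, y₁, 1] ![x₂, y₂, 1] := by
      rw [gY, fX, fY, fZ]
      linear_combination eY
    refine parallel_iff.mpr ⟨?_, kX, kY⟩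
    have hZ : W.toProjective.addZ ![x₁, y₁, 1] ![x₂, y₂, 1] ≠ 0 := by
      rw [fZ]; exact pow_ne_zero 3 hd
    apply mul_left_cancel₀ hZ
    simp only [altXYZ, addXYZ, fin3_def_ext]
    linear_combination W.toProjective.addY ![x₁, y₁, 1] ![x₂, y₂, 1] * kX
      - W.toProjective.addX ![x₁, y₁, 1] ![x₂, y₂, 1] * kY

theorem parallel_altXYZ_addXYZ {P Q : Fin 3 → F} (hP : W.toProjective.Nonsingular P)
    (hQ : W.toProjective.Nonsingular Q) (h : ¬ P ≈ Q) :
    Parallel (altXYZ W P Q) (W.toProjective.addXYZ P Q) := by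
  by_cases hPz : P 2 = 0
  · have hx : P 0 = 0 := X_eq_zero_of_Z_eq_zero hP.1 hPz
    rw [addXYZ_of_Z_eq_zero_left hP.1 hPz]
    have : altXYZ W P Q = (P 1 ^ 2 * (Q 1 + W.a₁ * Q 0 + W.a₃ * Q 2)) • Q := by
      ext i
      fin_cases i <;>
        simp [altXYZ, altX, altY, altZ, addY, addX, negAddY, addZ, neg, negY, hx, hPz] <;> ring
    rw [this]
    exact (parallel_refl Q).smul _ _
  by_cases hQz : Q 2 = 0
  · have hx : Q 0 = 0 := X_eq_zero_of_Z_eq_zero hQ.1 hQz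
    rw [addXYZ_of_Z_eq_zero_right hQ.1 hQz]
    have : altXYZ W P Q = (Q 1 ^ 2 * P 1) • P := by
      ext i
      fin_cases i <;>
        simp [altXYZ, altX, altY, altZ, addY, addX, negAddY, addZ, neg, negY, hx, hQz] <;> ring
    rw [this]
    exact (parallel_refl P).smul _ _
  have hne : ¬ (P 0 / P 2 = Q 0 / Q 2 ∧ P 1 / P 2 = Q 1 / Q 2) := fun ⟨h₁, h₂⟩ =>
    h <| equiv_of_X_eq_of_Y_eq hPz hQz ((div_eq_div_iff hPz hQz).mp h₁)
      ((div_eq_div_iff hPz hQz).mp h₂)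
  have key := parallel_altXYZ_affine W (equation_affine W hP.1 hPz) (equation_affine W hQ.1 hQz) hne
  rw [eq_smul_affine hPz, eq_smul_affine hQz, altXYZ_smul, addXYZ_smul]
  exact key.smul _ _

/-- Over a field, both addition laws compute Mathlib's sum of two nonsingular points. -/
theorem parallel_add {P Q : Fin 3 → F} (hP : W.toProjective.Nonsingular P)
    (hQ : W.toProjective.Nonsingular Q) :
    Parallel (W.toProjective.addXYZ P Q) (W.toProjective.add P Q) ∧
      Parallel (altXYZ W P Q) (W.toProjective.add P Q) := by
  by_cases h : P ≈ Q
  · rw [add_of_equiv h]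
    obtain ⟨a, rfl⟩ := h
    have hQ' : altXYZ W ((a : F) • Q) ((1 : F) • Q) = ((a : F) * 1) ^ 2 • altXYZ W Q Q :=
      altXYZ_smul ..
    have hQ'' : W.toProjective.addXYZ ((a : F) • Q) ((1 : F) • Q) =
      ((a : F) * 1) ^ 2 • W.toProjective.addXYZ Q Q := addXYZ_smul ..
    rw [one_smul] at hQ' hQ''
    constructor
    · change Parallel (W.toProjective.addXYZ ((a : F) • Q) Q) _
      rw [hQ'', addXYZ_self]
      intro i j
      fin_cases i <;> fin_cases j <;> simp
    · change Parallel (altXYZ W ((a : F) • Q) Q) (W.toProjective.dblXYZ ((a : F) • Q))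
      rw [hQ', altXYZ_self W hQ.1, dblXYZ_smul]
      exact (parallel_refl _).smul _ _
  · rw [add_of_not_equiv h]
    exact ⟨parallel_refl _, parallel_altXYZ_addXYZ W hP hQ h⟩

theorem ne_zero_of_nonsingular {P : Fin 3 → F} (hP : W.toProjective.Nonsingular P) : P ≠ 0 := by
  rintro rfl
  simp [nonsingular_iff] at hP

/-- Over a field, the two addition laws do not vanish simultaneously. -/
theorem addXYZ_ne_zero_or {P Q : Fin 3 → F} (hP : W.toProjective.Nonsingular P)
    (hQ : W.toProjective.Nonsingular Q) :
    W.toProjective.addXYZ P Q ≠ 0 ∨ altXYZ W P Q ≠ 0 := by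
  have hS := ne_zero_of_nonsingular W (nonsingular_add hP hQ)
  by_cases h : P ≈ Q
  · right
    rw [add_of_equiv h] at hS
    obtain ⟨a, rfl⟩ := h
    have h' : altXYZ W ((a : F) • Q) ((1 : F) • Q) = ((a : F) * 1) ^ 2 • altXYZ W Q Q :=
      altXYZ_smul ..
    change W.toProjective.dblXYZ ((a : F) • Q) ≠ 0 at hS
    change altXYZ W ((a : F) • Q) Q ≠ 0
    rw [one_smul, altXYZ_self W hQ.1] at h'
    rw [dblXYZ_smul] at hS
    rw [h']
    exact smul_ne_zero (by simp) (right_ne_zero_of_smul hS)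
  · left
    rwa [add_of_not_equiv h] at hS

theorem nonsingular_of_ne_zero [W.IsElliptic] {P : Fin 3 → F} (hP : W.toProjective.Equation P)
    (h0 : P ≠ 0) : W.toProjective.Nonsingular P := by
  by_cases hz : P 2 = 0
  · rw [nonsingular_of_Z_eq_zero hz]
    have hx : P 0 = 0 := X_eq_zero_of_Z_eq_zero hP hz
    refine ⟨hP, Or.inr ?_⟩
    have hy : P 1 ≠ 0 := fun hy => h0 <| by ext i; fin_cases i <;> simp [hx, hy, hz]
    simpa [hx] using hy
  · rw [nonsingular_of_Z_ne_zero hz]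
    rw [equation_of_Z_ne_zero hz] at hP
    exact Affine.equation_iff_nonsingular.mp hP

end Field

/-! ### Points with values in a ring -/

/-- A vector is primitive if its entries generate the unit ideal. -/
def IsPrimitive {R : Type u} [CommRing R] (v : Fin 3 → R) : Prop :=
  ∃ c : Fin 3 → R, c 0 * v 0 + c 1 * v 1 + c 2 * v 2 = 1

/-- A vector of homogeneous coordinates of an `R`-valued point of the projective closure of `W`. -/
def IsCoord {R : Type u} [CommRing R] (W : WeierstrassCurve R) (v : Fin 3 → R) : Prop :=
  IsPrimitive v ∧ W.toProjective.Equation v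

/-- The points `[x : y : z]` with values in `R` of the projective closure of `W`: primitive
solutions of the homogeneous Weierstrass equation up to multiplication by units.  If every
invertible `R`-module is free, as for `R = ℤ/nℤ` with `n ≠ 0`, then these are all the sections over
`Spec R` of the plane cubic over `R` with this equation. -/
def RPoint {R : Type u} [CommRing R] (W : WeierstrassCurve R) : Type u :=
  {P : PointClass R // ∃ v, IsCoord W v ∧ ⟦v⟧ = P}

/-- The point with the homogeneous coordinates `v`. -/
def RPoint.mk {R : Type u} [CommRing R] {W : WeierstrassCurve R} (v : Fin 3 → R)
    (hv : IsCoord W v) : RPoint W := ⟨⟦v⟧, v, hv, rfl⟩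

/-- `s` represents the sum of the points represented by `v` and `w`: both addition laws,
applied to `v` and `w`, yield multiples of `s`. -/
def IsSumCoord {R : Type u} [CommRing R] (W : WeierstrassCurve R) (v w s : Fin 3 → R) : Prop :=
  Parallel (W.toProjective.addXYZ v w) s ∧ Parallel (altXYZ W v w) s

/-- The relation `P + Q = S` on points. -/
def IsSum {R : Type u} [CommRing R] {W : WeierstrassCurve R} (P Q S : RPoint W) : Prop :=
  ∃ v w s : Fin 3 → R, ⟦v⟧ = P.1 ∧ ⟦w⟧ = Q.1 ∧ ⟦s⟧ = S.1 ∧ IsSumCoord W v w s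

theorem isCoord_zero {R : Type u} [CommRing R] (W : WeierstrassCurve R) :
    IsCoord W ![0, 1, 0] := ⟨⟨![0, 1, 0], by simp⟩, equation_zero⟩

theorem IsCoord.neg {R : Type u} [CommRing R] {W : WeierstrassCurve R} {v : Fin 3 → R}
    (hv : IsCoord W v) : IsCoord W (W.toProjective.neg v) := by
  obtain ⟨⟨c, hc⟩, he⟩ := hv
  refine ⟨⟨![c 0 - W.a₁ * c 1, -c 1, c 2 - W.a₃ * c 1], ?_⟩, ?_⟩
  · simp only [Projective.neg, negY, fin3_def_ext]
    linear_combination hc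
  · rw [equation_iff] at he ⊢
    simp only [Projective.neg, negY, fin3_def_ext]
    linear_combination he

/-- The origin `[0 : 1 : 0]`. -/
instance {R : Type u} [CommRing R] (W : WeierstrassCurve R) : Zero (RPoint W) :=
  ⟨RPoint.mk ![0, 1, 0] (isCoord_zero W)⟩

/-- The negative `[x : -y - a₁ x - a₃ z : z]` of `[x : y : z]`. -/
instance {R : Type u} [CommRing R] (W : WeierstrassCurve R) : Neg (RPoint W) :=
  ⟨fun P => ⟨W.toProjective.negMap P.1, by
    obtain ⟨v, hv, h⟩ := P.2
    exact ⟨W.toProjective.neg v, hv.neg, by rw [← h]; rfl⟩⟩⟩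

open Classical in
/-- The sum of two points. -/
noncomputable instance {R : Type u} [CommRing R] (W : WeierstrassCurve R) : Add (RPoint W) :=
  ⟨fun P Q => if h : ∃ S, IsSum P Q S then h.choose else 0⟩

theorem IsPrimitive.map {R S : Type*} [CommRing R] [CommRing S] (f : R →+* S) {v : Fin 3 → R}
    (h : IsPrimitive v) : IsPrimitive (f ∘ v) := by
  obtain ⟨c, hc⟩ := h
  exact ⟨f ∘ c, by simp only [Function.comp_apply, ← map_mul, ← map_add, hc, map_one]⟩

theorem IsCoord.map {R S : Type*} [CommRing R] [CommRing S] (f : R →+* S) {W : WeierstrassCurve R}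
    {v : Fin 3 → R} (h : IsCoord W v) : IsCoord (W.map f) (f ∘ v) :=
  ⟨h.1.map f, h.2.map f⟩

theorem IsSumCoord.map {R S : Type*} [CommRing R] [CommRing S] (f : R →+* S)
    {W : WeierstrassCurve R} {v w s : Fin 3 → R} (h : IsSumCoord W v w s) :
    IsSumCoord (W.map f) (f ∘ v) (f ∘ w) (f ∘ s) := by
  refine ⟨?_, ?_⟩
  · have := h.1.map f
    rwa [← map_addXYZ] at this
  · have := h.2.map f
    rwa [← altXYZ_map] at this

theorem equiv_of_parallel {R : Type u} [CommRing R] {v w : Fin 3 → R} (hv : IsPrimitive v)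
    (hw : IsPrimitive w) (h : Parallel v w) : v ≈ w := by
  obtain ⟨c, hc⟩ := hv
  obtain ⟨d, hd⟩ := hw
  have hvw i : v i = (d 0 * v 0 + d 1 * v 1 + d 2 * v 2) * w i := by
    linear_combination -v i * hd + d 0 * h i 0 + d 1 * h i 1 + d 2 * h i 2
  have hab : (d 0 * v 0 + d 1 * v 1 + d 2 * v 2) * (c 0 * w 0 + c 1 * w 1 + c 2 * w 2) = 1 := by
    linear_combination hc - c 0 * hvw 0 - c 1 * hvw 1 - c 2 * hvw 2
  refine ⟨Units.mkOfMulEqOne _ _ hab, ?_⟩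
  ext i
  exact (hvw i).symm

theorem Parallel.of_equiv {R : Type u} [CommRing R] {v w v' w' : Fin 3 → R} (h : Parallel v w)
    (hv : v ≈ v') (hw : w ≈ w') : Parallel v' w' := by
  obtain ⟨a, rfl⟩ := Setoid.symm hv
  obtain ⟨b, rfl⟩ := Setoid.symm hw
  exact h.smul (a : R) (b : R)

theorem addXYZ_equiv {R : Type u} [CommRing R] (W : WeierstrassCurve R) {v w v' w' : Fin 3 → R}
    (hv : v ≈ v') (hw : w ≈ w') : W.toProjective.addXYZ v w ≈ W.toProjective.addXYZ v' w' := by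
  obtain ⟨a, rfl⟩ := hv
  obtain ⟨b, rfl⟩ := hw
  exact ⟨(a * b) ^ 2, (addXYZ_smul (W' := W) v' w' (a : R) (b : R)).symm⟩

theorem altXYZ_equiv {R : Type u} [CommRing R] (W : WeierstrassCurve R) {v w v' w' : Fin 3 → R}
    (hv : v ≈ v') (hw : w ≈ w') : altXYZ W v w ≈ altXYZ W v' w' := by
  obtain ⟨a, rfl⟩ := hv
  obtain ⟨b, rfl⟩ := hw
  exact ⟨(a * b) ^ 2, (altXYZ_smul W v' w' (a : R) (b : R)).symm⟩

theorem IsSumCoord.of_equiv {R : Type u} [CommRing R] {W : WeierstrassCurve R}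
    {v w s v' w' s' : Fin 3 → R} (h : IsSumCoord W v w s) (hv : v ≈ v') (hw : w ≈ w')
    (hs : s ≈ s') : IsSumCoord W v' w' s' :=
  ⟨h.1.of_equiv (addXYZ_equiv W hv hw) hs, h.2.of_equiv (altXYZ_equiv W hv hw) hs⟩

/-- On an elliptic curve, the two addition laws generate the unit ideal. -/
theorem span_laws {R : Type u} [CommRing R] (W : WeierstrassCurve R) [W.IsElliptic]
    {v w : Fin 3 → R} (hv : IsCoord W v) (hw : IsCoord W w) :
    Ideal.span (Set.range (W.toProjective.addXYZ v w) ∪ Set.range (altXYZ W v w)) = ⊤ := by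
  by_contra hI
  obtain ⟨m, hm, hle⟩ := Ideal.exists_le_maximal _ hI
  let := Ideal.Quotient.field m
  set f := Ideal.Quotient.mk m
  have hns {v : Fin 3 → R} (hv : IsCoord W v) : (W.map f).toProjective.Nonsingular (f ∘ v) := by
    refine nonsingular_of_ne_zero _ (hv.map f).2 fun h0 => ?_
    obtain ⟨c, hc⟩ := (hv.map f).1
    rw [h0] at hc
    simp at hc
  rw [Ideal.span_le] at hle
  rcases addXYZ_ne_zero_or _ (hns hv) (hns hw) with h | h
  · apply h
    rw [map_addXYZ]
    ext i
    exact Ideal.Quotient.eq_zero_iff_mem.mpr (hle (Or.inl ⟨i, rfl⟩))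
  · apply h
    rw [altXYZ_map]
    ext i
    exact Ideal.Quotient.eq_zero_iff_mem.mpr (hle (Or.inr ⟨i, rfl⟩))

theorem parallel_of_isSumCoord {R : Type u} [CommRing R] (W : WeierstrassCurve R) [W.IsElliptic]
    {v w s s' : Fin 3 → R} (hv : IsCoord W v) (hw : IsCoord W w) (h : IsSumCoord W v w s)
    (h' : IsSumCoord W v w s') : Parallel s s' := by
  intro i j
  rw [← sub_eq_zero]
  have key {L : Fin 3 → R} (hL : Parallel L s) (hL' : Parallel L s') (k : Fin 3) :
      L k * (s i * s' j - s j * s' i) = 0 := by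
    linear_combination s i * hL' k j - s j * hL' k i - s' k * hL i j
  have h1 : (1 : R) ∈ Ideal.span
      (Set.range (W.toProjective.addXYZ v w) ∪ Set.range (altXYZ W v w)) := by
    rw [span_laws W hv hw]; trivial
  rw [← one_mul (s i * s' j - s j * s' i)]
  refine Submodule.span_induction (p := fun x _ => x * (s i * s' j - s j * s' i) = 0)
    ?_ ?_ ?_ ?_ h1
  · rintro x (⟨k, rfl⟩ | ⟨k, rfl⟩)
    · exact key h.1 h'.1 k
    · exact key h.2 h'.2 k
  · simp
  · intro x y _ _ hx hy
    rw [add_mul, hx, hy, add_zero]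
  · intro a x _ hx
    rw [smul_eq_mul, mul_assoc, hx, mul_zero]

theorem mk_add_mk {R : Type u} [CommRing R] {W : WeierstrassCurve R} [W.IsElliptic]
    {v w s : Fin 3 → R} (hv : IsCoord W v) (hw : IsCoord W w) (hs : IsCoord W s)
    (h : IsSumCoord W v w s) : RPoint.mk v hv + RPoint.mk w hw = RPoint.mk s hs := by
  have hex : ∃ S, IsSum (RPoint.mk v hv) (RPoint.mk w hw) S :=
    ⟨RPoint.mk s hs, v, w, s, rfl, rfl, rfl, h⟩
  classical
  change (if h : ∃ S, IsSum (RPoint.mk v hv) (RPoint.mk w hw) S then h.choose else 0) = _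
  rw [dif_pos hex]
  obtain ⟨v', w', s', hv', hw', hs', h'⟩ := hex.choose_spec
  obtain ⟨t, ht, hst⟩ := hex.choose.2
  refine Subtype.ext (hst.symm.trans (Quotient.sound ?_))
  have hs't : s' ≈ t := Quotient.exact (hs'.trans hst.symm)
  exact equiv_of_parallel ht.1 hs.1 <| parallel_of_isSumCoord W hv hw
    (h'.of_equiv (Quotient.exact hv') (Quotient.exact hw') hs't) h

/-! ### The group law on points with values in `ℤ/nℤ` -/

theorem fact_prime_of_mem {n : ℕ} (p : n.primeFactors) : Fact (p : ℕ).Prime :=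
  ⟨Nat.prime_of_mem_primeFactors p.2⟩

section Lift

attribute [local instance] fact_prime_of_mem

variable {n : ℕ}

/-- The reduction map from the product of the `p`-adic integers over the primes `p ∣ n`. -/
noncomputable def padicToZMod (n : ℕ) [NeZero n] : (∀ p : n.primeFactors, ℤ_[p]) →+* ZMod n :=
  (ZMod.equivPi n (NeZero.ne n)).symm.toRingHom.comp
    (RingHom.pi fun p => (PadicInt.toZModPow (n.factorization p)).comp (Pi.evalRingHom _ p))

theorem padicToZMod_eq [NeZero n] {x : ∀ p : n.primeFactors, ℤ_[p]} {m : ℤ}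
    (h : ∀ p : n.primeFactors, PadicInt.toZModPow (n.factorization p) (x p) = m) :
    padicToZMod n x = m := by
  have : (RingHom.pi fun p : n.primeFactors =>
      (PadicInt.toZModPow (n.factorization p)).comp (Pi.evalRingHom (fun p : n.primeFactors => ℤ_[p]) p)) x = m := by
    funext p
    exact h p
  change (ZMod.equivPi n (NeZero.ne n)).symm _ = _
  rw [this, map_intCast]

/-- The projection to the `p`-adic numbers. -/
noncomputable def padicProj (p : n.primeFactors) : (∀ p : n.primeFactors, ℤ_[p]) →+* ℚ_[p] :=
  PadicInt.Coe.ringHom.comp (Pi.evalRingHom _ p)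

theorem ext_padicProj {x y : ∀ p : n.primeFactors, ℤ_[p]}
    (h : ∀ p : n.primeFactors, padicProj p x = padicProj p y) : x = y := by
  funext p
  exact PadicInt.ext (h p)

theorem isPrimitive_of_isUnit {R : Type*} [CommRing R] {w : Fin 3 → R} (i : Fin 3)
    (h : IsUnit (w i)) : IsPrimitive w := by
  obtain ⟨u, hu⟩ := h.exists_left_inv
  refine ⟨Pi.single i u, ?_⟩
  fin_cases i <;> simpa using hu

theorem exists_primitive {p : ℕ} [Fact p.Prime] {v : Fin 3 → ℚ_[p]} (hv : v ≠ 0) :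
    ∃ w : Fin 3 → ℤ_[p], IsPrimitive w ∧ ∃ c : ℚ_[p], c ≠ 0 ∧ PadicInt.Coe.ringHom ∘ w = c • v := by
  obtain ⟨j, hj⟩ := Finite.exists_max fun i => ‖v i‖
  have hj0 : v j ≠ 0 := fun h => hv <| by
    ext i
    have := hj i
    rw [h, norm_zero] at this
    simpa using this
  have hle i : ‖(v j)⁻¹ * v i‖ ≤ 1 := by
    rw [norm_mul, norm_inv]
    exact inv_mul_le_one_of_le₀ (hj i) (norm_nonneg _)
  refine ⟨fun i => ⟨(v j)⁻¹ * v i, hle i⟩, isPrimitive_of_isUnit j ?_, (v j)⁻¹, inv_ne_zero hj0, rfl⟩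
  have h1 : (Subtype.mk ((v j)⁻¹ * v j) (hle j) : ℤ_[p]) = (1 : ℤ_[p]) :=
    PadicInt.ext (inv_mul_cancel₀ hj0)
  exact isUnit_iff_exists_inv.mpr ⟨1, (mul_one _).trans h1⟩

variable (W : WeierstrassCurve ℤ)

theorem map_int {R S : Type*} [CommRing R] [CommRing S] (f : R →+* S) :
    (W.map (Int.castRingHom R)).map f = W.map (Int.castRingHom S) := by
  rw [WeierstrassCurve.map_map]
  congr 1
  exact RingHom.ext_int _ _

theorem exists_coord_of_family (g : ∀ p : n.primeFactors,
      (W.map (Int.castRingHom ℚ_[p])).toProjective.Point) :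
    ∃ v : Fin 3 → ∀ p : n.primeFactors, ℤ_[p],
      IsCoord (W.map (Int.castRingHom _)) v ∧ ∀ p, ⟦padicProj p ∘ v⟧ = (g p).point := by
  have key (p : n.primeFactors) : ∃ w : Fin 3 → ℤ_[p], IsCoord (W.map (Int.castRingHom _)) w ∧
      ⟦PadicInt.Coe.ringHom ∘ w⟧ = (g p).point := by
    obtain ⟨u, hu⟩ := Quotient.exists_rep (g p).point
    have hns : (W.map (Int.castRingHom ℚ_[p])).toProjective.Nonsingular u := by
      have := (g p).nonsingular
      rwa [← hu] at this
    obtain ⟨w, hw, c, hc, hcw⟩ := exists_primitive (ne_zero_of_nonsingular _ hns)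
    refine ⟨w, ⟨hw, ?_⟩, ?_⟩
    · rw [← map_equation (f := PadicInt.Coe.ringHom) _ (fun a b h => PadicInt.ext h), hcw,
        equation_smul _ hc.isUnit]
      have := map_int W (PadicInt.Coe.ringHom (p := p))
      have h3 := hns.1
      rw [← this] at h3
      exact h3
    · rw [hcw, smul_eq _ hc.isUnit, hu]
  choose w hw hwg using key
  choose c hc using fun p => (hw p).1
  refine ⟨fun i p => w p i, ⟨⟨fun i p => c p i, funext hc⟩, ?_⟩, hwg⟩
  rw [equation_iff]
  funext p
  have := (equation_iff _).mp (hw p).2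
  simpa using this

theorem isSumCoord_of_family (g h : ∀ p : n.primeFactors,
      (W.map (Int.castRingHom ℚ_[p])).toProjective.Point)
    {v w s : Fin 3 → ∀ p : n.primeFactors, ℤ_[p]}
    (hv : ∀ p, ⟦padicProj p ∘ v⟧ = (g p).point) (hw : ∀ p, ⟦padicProj p ∘ w⟧ = (h p).point)
    (hs : ∀ p, ⟦padicProj p ∘ s⟧ = (g p + h p).point) :
    IsSumCoord (W.map (Int.castRingHom _)) v w s := by
  have key (p : n.primeFactors) :
      IsSumCoord ((W.map (Int.castRingHom (∀ p : n.primeFactors, ℤ_[p]))).map (padicProj p))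
        (padicProj p ∘ v) (padicProj p ∘ w) (padicProj p ∘ s) := by
    rw [map_int]
    have h1 := (g p).nonsingular
    have h2 := (h p).nonsingular
    have h3 := hs p
    rw [Point.add_point, ← hv p, ← hw p] at h3
    rw [← hv p] at h1
    rw [← hw p] at h2
    have h4 := Setoid.symm (Quotient.exact h3)
    have h5 := parallel_add _ h1 h2
    exact ⟨h5.1.of_equiv (Setoid.refl _) h4, h5.2.of_equiv (Setoid.refl _) h4⟩
  constructor
  · intro i j
    refine ext_padicProj fun p => ?_
    have := (key p).1 i j
    rw [map_addXYZ] at this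
    simpa using this
  · intro i j
    refine ext_padicProj fun p => ?_
    have := (key p).2 i j
    rw [altXYZ_map] at this
    simpa using this

theorem hensel_cubic {p : ℕ} [Fact p.Prime] {k : ℕ} (hk : k ≠ 0) {c₃ c₂ c₁ c₀ a : ℤ_[p]}
    (hd : ‖3 * c₃ * a ^ 2 + 2 * c₂ * a + c₁‖ = 1)
    (h : PadicInt.toZModPow k (c₃ * a ^ 3 + c₂ * a ^ 2 + c₁ * a + c₀) = 0) :
    ∃ z : ℤ_[p], c₃ * z ^ 3 + c₂ * z ^ 2 + c₁ * z + c₀ = 0 ∧ ‖z - a‖ < 1 ∧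
      PadicInt.toZModPow k z = PadicInt.toZModPow k a := by
  open Polynomial in
  let f : ℤ_[p][X] := C c₃ * X ^ 3 + C c₂ * X ^ 2 + C c₁ * X + C c₀
  have hf (t : ℤ_[p]) : Polynomial.aeval t f = c₃ * t ^ 3 + c₂ * t ^ 2 + c₁ * t + c₀ := by
    simp [f]
  have hf' (t : ℤ_[p]) :
      Polynomial.aeval t f.derivative = 3 * c₃ * t ^ 2 + 2 * c₂ * t + c₁ := by
    simp [f]
    ring
  have hlt : ‖c₃ * a ^ 3 + c₂ * a ^ 2 + c₁ * a + c₀‖ < 1 := by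
    rw [PadicInt.norm_lt_one_iff_dvd]
    rw [← RingHom.mem_ker, PadicInt.ker_toZModPow, Ideal.mem_span_singleton] at h
    exact (dvd_pow_self _ hk).trans h
  obtain ⟨z, hz, hza, -, -⟩ := hensels_lemma (F := f) (a := a) (by
    rw [hf, hf', hd, one_pow]; exact hlt)
  rw [hf] at hz
  rw [hf', hd] at hza
  refine ⟨z, hz, hza, ?_⟩
  have hu : IsUnit (3 * c₃ * a ^ 2 + 2 * c₂ * a + c₁ + (z - a) * (c₃ * (z + 2 * a) + c₂)) := by
    have h1 : ‖(z - a) * (c₃ * (z + 2 * a) + c₂)‖ < 1 := by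
      rw [norm_mul]
      exact mul_lt_one_of_nonneg_of_lt_one_left (norm_nonneg _) hza (PadicInt.norm_le_one _)
    rw [PadicInt.isUnit_iff, PadicInt.norm_add_eq_max_of_ne (by rw [hd]; exact h1.ne'), hd]
    exact max_eq_left h1.le
  have heq : (z - a) * (3 * c₃ * a ^ 2 + 2 * c₂ * a + c₁ + (z - a) * (c₃ * (z + 2 * a) + c₂)) =
      -(c₃ * a ^ 3 + c₂ * a ^ 2 + c₁ * a + c₀) := by
    linear_combination hz
  have := congrArg (PadicInt.toZModPow k) heq
  rw [map_mul, map_neg, h, neg_zero, (hu.map (PadicInt.toZModPow k)).mul_left_eq_zero, map_sub,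
    sub_eq_zero] at this
  exact this

theorem norm_intCast_eq_one {p : ℕ} [Fact p.Prime] {d : ℤ} (h : (d : ZMod p) ≠ 0) :
    ‖(d : ℤ_[p])‖ = 1 := by
  refine le_antisymm (PadicInt.norm_le_one _) (not_lt.mp fun hlt => h ?_)
  rw [PadicInt.norm_int_lt_one_iff_dvd] at hlt
  exact (ZMod.intCast_zmod_eq_zero_iff_dvd d p).mpr hlt

theorem exists_lift_local {p : ℕ} [Fact p.Prime] {k : ℕ} (hk : k ≠ 0)
    [(W.map (Int.castRingHom (ZMod p))).IsElliptic] {m : Fin 3 → ℤ}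
    (h : (W.map (Int.castRingHom (ZMod (p ^ k)))).toProjective.Equation
      (Int.castRingHom (ZMod (p ^ k)) ∘ m))
    (h' : IsCoord (W.map (Int.castRingHom (ZMod p))) (Int.castRingHom (ZMod p) ∘ m)) :
    ∃ w : Fin 3 → ℤ_[p], IsCoord (W.map (Int.castRingHom ℤ_[p])) w ∧
      ∀ i, PadicInt.toZModPow k (w i) = m i := by
  have h0 : Int.castRingHom (ZMod p) ∘ m ≠ 0 := fun h0 => by
    obtain ⟨c, hc⟩ := h'.1
    rw [h0] at hc
    simp at hc
  have hns := nonsingular_of_ne_zero _ h'.2 h0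
  have hprim (w : Fin 3 → ℤ_[p]) (hw : ∀ i, ‖w i - m i‖ < 1) : IsPrimitive w := by
    obtain ⟨i, hi⟩ := Function.ne_iff.mp h0
    have h1 : ‖(m i : ℤ_[p])‖ = 1 := norm_intCast_eq_one hi
    have h2 : IsUnit (w i) := by
      rw [PadicInt.isUnit_iff, ← sub_add_cancel (w i) (m i),
        PadicInt.norm_add_eq_max_of_ne (by rw [h1]; exact (hw i).ne), h1]
      exact max_eq_right (hw i).le
    exact isPrimitive_of_isUnit i h2
  rw [nonsingular_iff] at hns
  rw [equation_iff] at h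
  simp only [Function.comp_apply, map_a₁, map_a₂, map_a₃, map_a₄, map_a₆, Int.coe_castRingHom]
    at hns h
  rcases hns.2 with hd | hd | hd
  · obtain ⟨z, hz, hz1, hz2⟩ := hensel_cubic (p := p) hk (c₃ := -1) (c₂ := -(W.a₂ * m 2 : ℤ))
      (c₁ := (W.a₁ * m 1 * m 2 - W.a₄ * m 2 ^ 2 : ℤ))
      (c₀ := (m 1 ^ 2 * m 2 + W.a₃ * m 1 * m 2 ^ 2 - W.a₆ * m 2 ^ 3 : ℤ)) (a := m 0)
      (by
        convert norm_intCast_eq_one (p := p) (d := W.a₁ * m 1 * m 2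
          - (3 * m 0 ^ 2 + 2 * W.a₂ * m 0 * m 2 + W.a₄ * m 2 ^ 2)) ?_ using 2
        · push_cast; ring
        · rw [← sub_ne_zero] at hd
          push_cast
          convert hd using 1
          ring)
      (by
        simp only [map_add, map_mul, map_neg, map_one, map_pow, map_intCast]
        push_cast
        linear_combination h)
    refine ⟨![z, m 1, m 2], ⟨hprim _ ?_, ?_⟩, ?_⟩
    · intro i; fin_cases i <;> simp [hz1]
    · rw [equation_iff]
      simp only [fin3_def_ext, map_a₁, map_a₂, map_a₃, map_a₄, map_a₆, Int.coe_castRingHom]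
      push_cast at hz
      linear_combination hz
    · intro i; fin_cases i <;> simp [hz2]
  · obtain ⟨z, hz, hz1, hz2⟩ := hensel_cubic (p := p) hk (c₃ := 0) (c₂ := (m 2 : ℤ))
      (c₁ := (W.a₁ * m 0 * m 2 + W.a₃ * m 2 ^ 2 : ℤ))
      (c₀ := -(m 0 ^ 3 + W.a₂ * m 0 ^ 2 * m 2 + W.a₄ * m 0 * m 2 ^ 2 + W.a₆ * m 2 ^ 3 : ℤ))
      (a := m 1)
      (by
        convert norm_intCast_eq_one (p := p) (d := 2 * m 1 * m 2 + W.a₁ * m 0 * m 2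
          + W.a₃ * m 2 ^ 2) ?_ using 2
        · push_cast; ring
        · push_cast
          convert hd using 1)
      (by
        simp only [map_add, map_mul, map_neg, map_zero, map_pow, map_intCast]
        push_cast
        linear_combination h)
    refine ⟨![m 0, z, m 2], ⟨hprim _ ?_, ?_⟩, ?_⟩
    · intro i; fin_cases i <;> simp [hz1]
    · rw [equation_iff]
      simp only [fin3_def_ext, map_a₁, map_a₂, map_a₃, map_a₄, map_a₆, Int.coe_castRingHom]
      push_cast at hz
      linear_combination hz
    · intro i; fin_cases i <;> simp [hz2]
  · obtain ⟨z, hz, hz1, hz2⟩ := hensel_cubic (p := p) hk (c₃ := -(W.a₆ : ℤ))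
      (c₂ := (W.a₃ * m 1 - W.a₄ * m 0 : ℤ))
      (c₁ := (m 1 ^ 2 + W.a₁ * m 0 * m 1 - W.a₂ * m 0 ^ 2 : ℤ))
      (c₀ := -(m 0 ^ 3 : ℤ)) (a := m 2)
      (by
        convert norm_intCast_eq_one (p := p) (d := m 1 ^ 2 + W.a₁ * m 0 * m 1
          + 2 * W.a₃ * m 1 * m 2 - (W.a₂ * m 0 ^ 2 + 2 * W.a₄ * m 0 * m 2
          + 3 * W.a₆ * m 2 ^ 2)) ?_ using 2
        · push_cast; ring
        · rw [← sub_ne_zero] at hd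
          push_cast
          convert hd using 1
          ring)
      (by
        simp only [map_add, map_mul, map_neg, map_pow, map_intCast]
        push_cast
        linear_combination h)
    refine ⟨![m 0, m 1, z], ⟨hprim _ ?_, ?_⟩, ?_⟩
    · intro i; fin_cases i <;> simp [hz1]
    · rw [equation_iff]
      simp only [fin3_def_ext, map_a₁, map_a₂, map_a₃, map_a₄, map_a₆, Int.coe_castRingHom]
      push_cast at hz
      linear_combination hz
    · intro i; fin_cases i <;> simp [hz2]

theorem exists_lift [NeZero n] [(W.map (Int.castRingHom (ZMod n))).IsElliptic] {v : Fin 3 → ZMod n}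
    (hv : IsCoord (W.map (Int.castRingHom (ZMod n))) v) :
    ∃ w : Fin 3 → ∀ p : n.primeFactors, ℤ_[p],
      IsCoord (W.map (Int.castRingHom _)) w ∧ padicToZMod n ∘ w = v := by
  choose m hm using fun i => ZMod.intCast_surjective (v i)
  have hred {d : ℕ} (hd : d ∣ n) :
      IsCoord (W.map (Int.castRingHom (ZMod d))) (Int.castRingHom (ZMod d) ∘ m) := by
    have := hv.map (ZMod.castHom hd (ZMod d))
    rw [map_int] at this
    convert this using 1
    ext i
    simp [← hm]
  have key (p : n.primeFactors) : ∃ w : Fin 3 → ℤ_[p],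
      IsCoord (W.map (Int.castRingHom ℤ_[p])) w ∧
      ∀ i, PadicInt.toZModPow (n.factorization p) (w i) = m i := by
    have hpn := Nat.dvd_of_mem_primeFactors p.2
    have : (W.map (Int.castRingHom (ZMod p))).IsElliptic := by
      rw [← map_int W (ZMod.castHom hpn (ZMod p))]
      infer_instance
    have hk : n.factorization p ≠ 0 :=
      ((Nat.prime_of_mem_primeFactors p.2).factorization_pos_of_dvd (NeZero.ne n) hpn).ne'
    exact exists_lift_local W hk (hred (Nat.ordProj_dvd n p)).2 (hred hpn)
  choose w hw hwm using key
  choose c hc using fun p => (hw p).1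
  refine ⟨fun i p => w p i, ⟨⟨fun i p => c p i, funext hc⟩, ?_⟩, ?_⟩
  · rw [equation_iff]
    funext p
    have := (equation_iff _).mp (hw p).2
    simpa using this
  · ext i
    rw [← hm i]
    exact padicToZMod_eq fun p => hwm p i

/-- `v` is a common lift of the point `P` over `ℤ/nℤ` and of the points `g p` over `ℚ_p`. -/
def IsLift [NeZero n] (g : ∀ p : n.primeFactors,
      (W.map (Int.castRingHom ℚ_[p])).toProjective.Point)
    (P : RPoint (W.map (Int.castRingHom (ZMod n)))) : Prop :=
  ∃ v : Fin 3 → ∀ p : n.primeFactors, ℤ_[p], IsCoord (W.map (Int.castRingHom _)) v ∧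
    (∀ p, ⟦padicProj p ∘ v⟧ = (g p).point) ∧ ⟦padicToZMod n ∘ v⟧ = P.1

variable {W}

theorem IsCoord.toZMod [NeZero n] {v : Fin 3 → ∀ p : n.primeFactors, ℤ_[p]}
    (hv : IsCoord (W.map (Int.castRingHom _)) v) :
    IsCoord (W.map (Int.castRingHom (ZMod n))) (padicToZMod n ∘ v) := by
  have := hv.map (padicToZMod n)
  rwa [map_int] at this

theorem IsLift.unique [NeZero n] {g : ∀ p : n.primeFactors,
      (W.map (Int.castRingHom ℚ_[p])).toProjective.Point}
    {P Q : RPoint (W.map (Int.castRingHom (ZMod n)))} (hP : IsLift W g P) (hQ : IsLift W g Q) :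
    P = Q := by
  obtain ⟨v, hv, hvg, hvP⟩ := hP
  obtain ⟨w, hw, hwg, hwQ⟩ := hQ
  refine Subtype.ext (hvP.symm.trans ((Quotient.sound ?_).trans hwQ))
  have key : Parallel v w := fun i j => ext_padicProj fun p => by
    have := (parallel_refl (padicProj p ∘ v)).of_equiv (Setoid.refl _)
      (Quotient.exact ((hvg p).trans (hwg p).symm)) i j
    simpa using this
  exact equiv_of_parallel (hv.1.map _) (hw.1.map _) (key.map _)

theorem IsLift.add [NeZero n] [(W.map (Int.castRingHom (ZMod n))).IsElliptic]
    {g h : ∀ p : n.primeFactors, (W.map (Int.castRingHom ℚ_[p])).toProjective.Point}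
    {P Q : RPoint (W.map (Int.castRingHom (ZMod n)))} (hP : IsLift W g P) (hQ : IsLift W h Q) :
    IsLift W (fun p => g p + h p) (P + Q) := by
  obtain ⟨v, hv, hvg, hvP⟩ := hP
  obtain ⟨w, hw, hwh, hwQ⟩ := hQ
  obtain ⟨s, hs, hsg⟩ := exists_coord_of_family W fun p => g p + h p
  have hsum := (isSumCoord_of_family W g h hvg hwh hsg).map (padicToZMod n)
  rw [map_int] at hsum
  refine ⟨s, hs, hsg, ?_⟩
  have hP' : P = RPoint.mk (padicToZMod n ∘ v) hv.toZMod := Subtype.ext hvP.symm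
  have hQ' : Q = RPoint.mk (padicToZMod n ∘ w) hw.toZMod := Subtype.ext hwQ.symm
  rw [hP', hQ', mk_add_mk hv.toZMod hw.toZMod hs.toZMod hsum]
  rfl

theorem isLift_zero [NeZero n] : IsLift W (fun _ : n.primeFactors => 0) 0 := by
  refine ⟨![0, 1, 0], isCoord_zero _, fun p => ?_, ?_⟩
  · rw [comp_fin3, map_zero, map_one]
    rfl
  · rw [comp_fin3, map_zero, map_one]
    rfl

theorem IsLift.neg [NeZero n] {g : ∀ p : n.primeFactors,
      (W.map (Int.castRingHom ℚ_[p])).toProjective.Point}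
    {P : RPoint (W.map (Int.castRingHom (ZMod n)))} (hP : IsLift W g P) :
    IsLift W (fun p => -g p) (-P) := by
  obtain ⟨v, hv, hvg, hvP⟩ := hP
  refine ⟨_, hv.neg, fun p => ?_, ?_⟩
  · have h := Projective.map_neg (W' := W.map (Int.castRingHom _)) (padicProj p) v
    rw [← h, Point.neg_point, ← hvg p]
    have := map_int W (padicProj p)
    change (⟦((W.map (Int.castRingHom _)).map (padicProj p)).toProjective.neg _⟧ :
      PointClass _) = _
    rw [this]
    rfl
  · have h := Projective.map_neg (W' := W.map (Int.castRingHom _)) (padicToZMod n) v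
    rw [← h]
    change _ = (W.map (Int.castRingHom (ZMod n))).toProjective.negMap P.1
    rw [← hvP]
    have := map_int W (padicToZMod n)
    change (⟦((W.map (Int.castRingHom _)).map (padicToZMod n)).toProjective.neg _⟧ :
      PointClass _) = _
    rw [this]
    rfl

theorem exists_isLift [NeZero n] [(W.map (Int.castRingHom (ZMod n))).IsElliptic]
    (P : RPoint (W.map (Int.castRingHom (ZMod n)))) :
    ∃ g : ∀ p : n.primeFactors, (W.map (Int.castRingHom ℚ_[p])).toProjective.Point,
      IsLift W g P := by
  obtain ⟨u, hu, huP⟩ := P.2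
  obtain ⟨v, hv, rfl⟩ := exists_lift W hu
  have hns (p : n.primeFactors) :
      (W.map (Int.castRingHom ℚ_[p])).toProjective.Nonsingular (padicProj p ∘ v) := by
    have hpn := Nat.dvd_of_mem_primeFactors p.2
    have : (W.map (Int.castRingHom ℚ_[p])).IsElliptic := by
      refine ⟨IsUnit.mk0 _ fun h0 => ?_⟩
      rw [map_Δ, eq_intCast, Int.cast_eq_zero] at h0
      have h1 := ((W.map (Int.castRingHom (ZMod n))).isUnit_Δ).map (ZMod.castHom hpn (ZMod p))
      rw [map_Δ, h0, map_zero, map_zero] at h1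
      exact not_isUnit_zero h1
    have hv' := hv.map (padicProj p)
    rw [map_int] at hv'
    refine nonsingular_of_ne_zero _ hv'.2 fun h0 => ?_
    obtain ⟨c, hc⟩ := hv'.1
    rw [h0] at hc
    simp at hc
  exact ⟨fun p => ⟨(nonsingularLift_iff _).mpr (hns p)⟩, v, hv, fun p => rfl, huP⟩

end Lift

theorem exists_int_model {n : ℕ} (W : WeierstrassCurve (ZMod n)) :
    ∃ W₀ : WeierstrassCurve ℤ, W₀.map (Int.castRingHom (ZMod n)) = W := by
  obtain ⟨a₁, h₁⟩ := ZMod.intCast_surjective W.a₁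
  obtain ⟨a₂, h₂⟩ := ZMod.intCast_surjective W.a₂
  obtain ⟨a₃, h₃⟩ := ZMod.intCast_surjective W.a₃
  obtain ⟨a₄, h₄⟩ := ZMod.intCast_surjective W.a₄
  obtain ⟨a₆, h₆⟩ := ZMod.intCast_surjective W.a₆
  exact ⟨⟨a₁, a₂, a₃, a₄, a₆⟩, WeierstrassCurve.ext h₁ h₂ h₃ h₄ h₆⟩

/-- The group of points with values in `ℤ/nℤ` of an elliptic curve over `ℤ/nℤ`. -/
noncomputable instance {n : ℕ} [NeZero n] (W : WeierstrassCurve (ZMod n)) [W.IsElliptic] :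
    AddCommGroup (RPoint W) where
  add_assoc := by
    obtain ⟨W, rfl⟩ := exists_int_model W
    intro P Q S
    obtain ⟨g, hg⟩ := exists_isLift P
    obtain ⟨h, hh⟩ := exists_isLift Q
    obtain ⟨k, hk⟩ := exists_isLift S
    have h1 := (hg.add hh).add hk
    simp only [add_assoc] at h1
    exact h1.unique (hg.add (hh.add hk))
  zero_add := by
    obtain ⟨W, rfl⟩ := exists_int_model W
    intro P
    obtain ⟨g, hg⟩ := exists_isLift P
    have h1 := isLift_zero.add hg
    simp only [zero_add] at h1
    exact h1.unique hg
  add_zero := by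
    obtain ⟨W, rfl⟩ := exists_int_model W
    intro P
    obtain ⟨g, hg⟩ := exists_isLift P
    have h1 := hg.add isLift_zero
    simp only [add_zero] at h1
    exact h1.unique hg
  neg_add_cancel := by
    obtain ⟨W, rfl⟩ := exists_int_model W
    intro P
    obtain ⟨g, hg⟩ := exists_isLift P
    have h1 := hg.neg.add hg
    simp only [neg_add_cancel] at h1
    exact h1.unique isLift_zero
  add_comm := by
    obtain ⟨W, rfl⟩ := exists_int_model W
    intro P Q
    obtain ⟨g, hg⟩ := exists_isLift P
    obtain ⟨h, hh⟩ := exists_isLift Q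
    have h1 := hg.add hh
    simp only [add_comm (g _)] at h1
    exact h1.unique (hh.add hg)
  nsmul := nsmulRec
  zsmul := zsmulRec

/-! ### Elliptic curves over `ℚ` -/

/-- `W` is an integral Weierstrass equation for `E/ℚ`. -/
def IsIntegralModel (E : WeierstrassCurve ℚ) (W : WeierstrassCurve ℤ) : Prop :=
  ∃ C : VariableChange ℚ, W.map (Int.castRingHom ℚ) = C • E

/-- `W` is a (global) minimal Weierstrass equation for `E/ℚ`: an integral equation whose
discriminant is as small as possible in absolute value. -/
def IsMinimalModel (E : WeierstrassCurve ℚ) (W : WeierstrassCurve ℤ) : Prop :=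
  IsIntegralModel E W ∧ ∀ W', IsIntegralModel E W' → W.Δ.natAbs ≤ W'.Δ.natAbs

theorem exists_isIntegralModel (E : WeierstrassCurve ℚ) : ∃ W, IsIntegralModel E W := by
  let d : ℕ := E.a₁.den * E.a₂.den * E.a₃.den * E.a₄.den * E.a₆.den
  have hd : (d : ℚ) ≠ 0 := by simp [d]
  have key (a : ℚ) (h : a.den ∣ d) {i : ℕ} (hi : i ≠ 0) : ∃ z : ℤ, (z : ℚ) = (d : ℚ) ^ i * a := by
    obtain ⟨e, he⟩ := h.trans (dvd_pow_self d hi)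
    refine ⟨e * a.num, ?_⟩
    have h1 : (d : ℚ) ^ i = a.den * e := by exact_mod_cast he
    rw [h1]
    push_cast
    linear_combination -(e : ℚ) * a.den_mul_eq_num
  obtain ⟨b₁, h₁⟩ := key E.a₁ (by simp only [d, mul_assoc, dvd_mul_right]) one_ne_zero
  obtain ⟨b₂, h₂⟩ := key E.a₂ ⟨E.a₁.den * E.a₃.den * E.a₄.den * E.a₆.den, by simp only [d]; ring⟩
    two_ne_zero
  obtain ⟨b₃, h₃⟩ := key E.a₃ ⟨E.a₁.den * E.a₂.den * E.a₄.den * E.a₆.den, by simp only [d]; ring⟩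
    three_ne_zero
  obtain ⟨b₄, h₄⟩ := key E.a₄ ⟨E.a₁.den * E.a₂.den * E.a₃.den * E.a₆.den, by simp only [d]; ring⟩
    four_ne_zero
  obtain ⟨b₆, h₆⟩ := key E.a₆ ⟨E.a₁.den * E.a₂.den * E.a₃.den * E.a₄.den, by simp only [d]; ring⟩
    (i := 6) (by norm_num)
  refine ⟨⟨b₁, b₂, b₃, b₄, b₆⟩, ⟨(Units.mk0 (d : ℚ) hd)⁻¹, 0, 0, 0⟩, ?_⟩
  ext
  · simp [variableChange_a₁, h₁]
  · simp [variableChange_a₂, h₂]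
  · simp [variableChange_a₃, h₃]
  · simp [variableChange_a₄, h₄]
  · simp [variableChange_a₆, h₆]

theorem exists_isMinimalModel (E : WeierstrassCurve ℚ) : ∃ W, IsMinimalModel E W := by
  obtain ⟨W, hW, h⟩ := exists_minimalFor_of_wellFoundedLT (IsIntegralModel E)
    (fun W => W.Δ.natAbs) (exists_isIntegralModel E)
  exact ⟨W, hW, fun W' hW' => (le_total _ _).elim id fun h' => h hW' h'⟩

/-- A minimal Weierstrass equation for `E/ℚ`. -/
noncomputable def minimalModel (E : WeierstrassCurve ℚ) : WeierstrassCurve ℤ :=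
  (exists_isMinimalModel E).choose

/-- The reduction modulo `n` of the minimal Weierstrass equation of `E/ℚ`. -/
noncomputable abbrev reductionMod (E : WeierstrassCurve ℚ) (n : ℕ) : WeierstrassCurve (ZMod n) :=
  (minimalModel E).map (Int.castRingHom (ZMod n))

/-- `E/ℚ` has good reduction at `p`: the minimal Weierstrass equation defines an elliptic curve
modulo `p`. -/
def HasGoodReductionAt (E : WeierstrassCurve ℚ) (p : ℕ) : Prop :=
  (reductionMod E p).IsElliptic

theorem isElliptic_reductionMod {E : WeierstrassCurve ℚ} {n : ℕ}
    (h : ∀ p : ℕ, p.Prime → p ∣ n → HasGoodReductionAt E p) : (reductionMod E n).IsElliptic := by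
  constructor
  rw [map_Δ, eq_intCast, ZMod.coe_int_isUnit_iff_isCoprime, Int.isCoprime_iff_gcd_eq_one]
  refine Nat.coprime_of_dvd fun p hp hpn hpΔ => ?_
  have hu := (h p hp (by simpa using hpn)).isUnit
  have : Fact p.Prime := ⟨hp⟩
  rw [map_Δ, eq_intCast, (ZMod.intCast_zmod_eq_zero_iff_dvd _ p).mpr
    (Int.natCast_dvd.mpr hpΔ)] at hu
  exact not_isUnit_zero hu

/-- The group `E(ℤ/nℤ)`. -/
abbrev PointsMod (E : WeierstrassCurve ℚ) (n : ℕ) : Type :=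
  RPoint (reductionMod E n)

theorem neZero_of_two_le {n : ℕ} (h : 2 ≤ n.primeFactors.card) : NeZero n :=
  ⟨by rintro rfl; simp at h⟩

/-- `n` is an elliptic pseudoprime for `(E, P)`, where `P ∈ E(ℤ/nℤ)`.  Here `E.LFunction n` is the
coefficient `a_n` of the `L`-series of `E/ℚ`. -/
structure IsEllipticPseudoprime (E : WeierstrassCurve ℚ) (n : ℕ) (P : PointsMod E n) : Prop where
  two_le_card : 2 ≤ n.primeFactors.card
  good : ∀ p : ℕ, p.Prime → p ∣ n → HasGoodReductionAt E p
  smul_eq_zero :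
    haveI := neZero_of_two_le two_le_card
    haveI := isElliptic_reductionMod good
    ((n : ℤ) + 1 - E.LFunction n) • P = 0

/-- `n` is an elliptic Carmichael number for `E`. -/
def IsEllipticCarmichael (E : WeierstrassCurve ℚ) (n : ℕ) : Prop :=
  ∀ P : PointsMod E n, IsEllipticPseudoprime E n P

theorem isElliptic_reductionMod_pow {E : WeierstrassCurve ℚ} {p : ℕ} (hp : p.Prime)
    (h : HasGoodReductionAt E p) (k : ℕ) : (reductionMod E (p ^ k)).IsElliptic :=
  isElliptic_reductionMod fun _ hq hqp =>
    (Nat.prime_dvd_prime_iff_eq hq hp).mp (hq.dvd_of_dvd_pow hqp) ▸ h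

/-- The exponent `e_{n,p}(E)` of the group `E(ℤ/p^{ord_p(n)}ℤ)`, for a prime `p` of good reduction. -/
noncomputable def localExponent (E : WeierstrassCurve ℚ) (n : ℕ) {p : ℕ} (hp : p.Prime)
    (h : HasGoodReductionAt E p) : ℕ :=
  haveI : NeZero (p ^ n.factorization p) := ⟨pow_ne_zero _ hp.ne_zero⟩
  haveI := isElliptic_reductionMod_pow hp h (n.factorization p)
  AddMonoid.exponent (PointsMod E (p ^ n.factorization p))

/-- `n` is an elliptic Korselt number for `E` of Type II. -/
structure IsEllipticKorseltII (E : WeierstrassCurve ℚ) (n : ℕ) : Prop where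
  two_le_card : 2 ≤ n.primeFactors.card
  good : ∀ p : ℕ, p.Prime → p ∣ n → HasGoodReductionAt E p
  exponent_dvd : ∀ (p : ℕ) (hp : p.Prime) (hpn : p ∣ n),
    (localExponent E n hp (good p hp hpn) : ℤ) ∣ (n : ℤ) + 1 - E.LFunction n

end EllKorselt

namespace EllKorselt

open WeierstrassCurve WeierstrassCurve.Projective

/-! ### Functoriality of the group of points -/

/-! The idea is the Chinese remainder theorem for points. Write n as the product of the prime powers
p^k exactly dividing it. Reduction gives group homomorphisms E(ℤ/nℤ) → E(ℤ/p^kℤ), which together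
form a bijection onto the product. Hence an integer N kills E(ℤ/nℤ) if and only if it kills every
factor, that is, if and only if the exponent of every factor divides N. The criterion is the case N
= n + 1 - a_n, and no property of a_n enters beyond its being an integer. The conditions on prime
factors and good reduction are common to both sides.

Bijectivity (`RPoint.ext_zmodProj`, `RPoint.exists_map_zmodProj_eq`) holds because a point is a
primitive solution of the Weierstrass equation up to units. Being primitive, being a solution and
being proportional are all polynomial equations, so they can be checked and solved separately in
each factor of ℤ/nℤ ≅ ∏ ℤ/p^kℤ.

Additivity (`RPoint.mapHom`) is the subtler point, since P + Q is chosen among the points S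
satisfying `IsSum P Q S`, with a default value if there is none. That relation is given by
polynomial identities, so ring homomorphisms preserve it; by `mk_add_mk` it determines S on an
elliptic curve. It remains to know that over ℤ/nℤ some S exists, which is `exists_isSumCoord`. -/

/-- The map on points induced by a ring homomorphism. -/
def RPoint.map {R S : Type*} [CommRing R] [CommRing S] (f : R →+* S) {W : WeierstrassCurve R}
    {W' : WeierstrassCurve S} (hf : W.map f = W') (P : RPoint W) : RPoint W' :=
  ⟨Quotient.map (f ∘ ·) (by
      rintro _ w ⟨a, rfl⟩
      exact ⟨Units.map f.toMonoidHom a, by ext i; simp [Units.smul_def]⟩) P.1, by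
    obtain ⟨v, hv, h⟩ := P.2
    exact ⟨f ∘ v, hf ▸ hv.map f, by rw [← h]; rfl⟩⟩

theorem RPoint.map_mk {R S : Type*} [CommRing R] [CommRing S] (f : R →+* S)
    {W : WeierstrassCurve R} {W' : WeierstrassCurve S} (hf : W.map f = W') {v : Fin 3 → R}
    (hv : IsCoord W v) : RPoint.map f hf (RPoint.mk v hv) = RPoint.mk (f ∘ v) (hf ▸ hv.map f) :=
  rfl

theorem RPoint.exists_mk {R : Type*} [CommRing R] {W : WeierstrassCurve R} (P : RPoint W) :
    ∃ v, ∃ hv : IsCoord W v, P = RPoint.mk v hv := by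
  obtain ⟨P, v, hv, rfl⟩ := P
  exact ⟨v, hv, rfl⟩

/-- Proportional primitive vectors differ by a unit: their Bézout coefficients produce both the
scalar and its inverse. Thus equality of points, an existence statement about units, becomes the
vanishing of 2 × 2 minors, which can be tested in each factor of a product ring without gluing
scalars. -/
theorem RPoint.mk_eq_mk_iff {R : Type*} [CommRing R] {W : WeierstrassCurve R} {v w : Fin 3 → R}
    (hv : IsCoord W v) (hw : IsCoord W w) : RPoint.mk v hv = RPoint.mk w hw ↔ Parallel v w :=
  ⟨fun h => (parallel_refl v).of_equiv (Setoid.refl _) (Quotient.exact (congrArg Subtype.val h)),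
    fun h => Subtype.ext (Quotient.sound (equiv_of_parallel hv.1 hw.1 h))⟩

theorem RPoint.map_zero {R S : Type*} [CommRing R] [CommRing S] (f : R →+* S)
    {W : WeierstrassCurve R} {W' : WeierstrassCurve S} (hf : W.map f = W') :
    RPoint.map f hf (0 : RPoint W) = 0 := by
  -- Both origins are by definition the class of [0 : 1 : 0], so it suffices to compare these
  -- coordinate vectors.
  refine (RPoint.mk_eq_mk_iff (hf ▸ (isCoord_zero W).map f) (isCoord_zero W')).mpr ?_
  change Parallel (f ∘ ![0, 1, 0]) _
  rw [comp_fin3, _root_.map_zero, map_one]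
  exact parallel_refl _

/-! ### Existence of sums over ℤ/nℤ and additivity of reduction -/

section Sum

attribute [local instance] fact_prime_of_mem

/-- Over `ℤ/nℤ`, any two points have a sum that is represented by a primitive vector. -/
theorem exists_isSumCoord {n : ℕ} [NeZero n] (W : WeierstrassCurve (ZMod n)) [W.IsElliptic]
    {v w : Fin 3 → ZMod n} (hv : IsCoord W v) (hw : IsCoord W w) :
    ∃ s, IsCoord W s ∧ IsSumCoord W v w s := by
  -- An integral equation for the curve can be read over ℤ/nℤ, ℤ_p and ℚ_p at once. Its points over
  -- ℤ/nℤ lift to the product of the ℤ_p for p ∣ n by Hensel's lemma.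
  obtain ⟨W, rfl⟩ := exists_int_model W
  obtain ⟨g, v', hv', hvg, hvP⟩ := exists_isLift (RPoint.mk v hv)
  obtain ⟨h, w', hw', hwh, hwQ⟩ := exists_isLift (RPoint.mk w hw)
  -- The points are added over the fields ℚ_p, where the group law is available. Dividing by a
  -- coordinate of largest norm makes the sum a primitive vector over ℤ_p, so that it can be
  -- reduced.
  obtain ⟨s, hs, hsg⟩ := exists_coord_of_family W fun p => g p + h p
  have hsum := (isSumCoord_of_family W g h hvg hwh hsg).map (padicToZMod n)
  rw [map_int] at hsum
  -- The lifts reduce to v and w only up to units, and `IsSumCoord` is insensitive to these.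
  exact ⟨_, hs.toZMod, hsum.of_equiv (Quotient.exact hvP) (Quotient.exact hwQ) (Setoid.refl _)⟩

end Sum

/-- A ring homomorphism `ℤ/nℤ → ℤ/dℤ` induces a homomorphism of groups of points. -/
def RPoint.mapHom {n d : ℕ} [NeZero n] [NeZero d] (f : ZMod n →+* ZMod d)
    {W : WeierstrassCurve (ZMod n)} {W' : WeierstrassCurve (ZMod d)} [W.IsElliptic] [W'.IsElliptic]
    (hf : W.map f = W') : RPoint W →+ RPoint W' where
  toFun := RPoint.map f hf
  map_zero' := RPoint.map_zero f hf
  map_add' P Q := by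
    obtain ⟨v, hv, rfl⟩ := P.exists_mk
    obtain ⟨w, hw, rfl⟩ := Q.exists_mk
    -- With explicit coordinates s for the sum, the default value in the definition of addition is
    -- excluded, and the image of s represents the sum of the images.
    obtain ⟨s, hs, h⟩ := exists_isSumCoord W hv hw
    rw [mk_add_mk hv hw hs h, RPoint.map_mk, RPoint.map_mk, RPoint.map_mk]
    exact (mk_add_mk _ _ _ (hf ▸ h.map f)).symm

/-! ### The Chinese remainder theorem for points -/

section CRT

variable {n : ℕ} [NeZero n]

/-- The projection from `ℤ/nℤ` to its factor at the prime `p`. -/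
noncomputable def zmodProj (p : n.primeFactors) : ZMod n →+* ZMod (p ^ n.factorization p) :=
  (Pi.evalRingHom _ p).comp (ZMod.equivPi n (NeZero.ne n)).toRingHom

theorem ext_zmodProj {x y : ZMod n} (h : ∀ p : n.primeFactors, zmodProj p x = zmodProj p y) :
    x = y :=
  (ZMod.equivPi n (NeZero.ne n)).injective (funext h)

theorem exists_zmodProj_eq (x : ∀ p : n.primeFactors, ZMod (p ^ n.factorization p)) :
    ∃ y : ZMod n, ∀ p, zmodProj p y = x p := by
  obtain ⟨y, hy⟩ := (ZMod.equivPi n (NeZero.ne n)).surjective x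
  exact ⟨y, fun p => congrFun hy p⟩

variable {W : WeierstrassCurve (ZMod n)}
  {W' : ∀ p : n.primeFactors, WeierstrassCurve (ZMod (p ^ n.factorization p))}

/-- A point over `ℤ/nℤ` is determined by its images over the factors `ℤ/p^kℤ`. -/
theorem RPoint.ext_zmodProj (hW : ∀ p, W.map (zmodProj p) = W' p) {P Q : RPoint W}
    (h : ∀ p, RPoint.map (zmodProj p) (hW p) P = RPoint.map (zmodProj p) (hW p) Q) : P = Q := by
  obtain ⟨v, hv, rfl⟩ := P.exists_mk
  obtain ⟨w, hw, rfl⟩ := Q.exists_mk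
  -- Each minor condition is one equation in ℤ/nℤ, hence follows from its images in the factors.
  refine (RPoint.mk_eq_mk_iff hv hw).mpr fun i j => EllKorselt.ext_zmodProj fun p => ?_
  have := (RPoint.mk_eq_mk_iff (hW p ▸ hv.map _) (hW p ▸ hw.map _)).mp (h p) i j
  simpa using this

/-- Every family of points over the factors `ℤ/p^kℤ` comes from a point over `ℤ/nℤ`. -/
theorem RPoint.exists_map_zmodProj_eq (hW : ∀ p, W.map (zmodProj p) = W' p)
    (Q : ∀ p, RPoint (W' p)) : ∃ P : RPoint W, ∀ p, RPoint.map (zmodProj p) (hW p) P = Q p := by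
  choose w hw hQ using fun p => (Q p).exists_mk
  -- The Bézout coefficients in the factors are glued along with the coordinates; the glued
  -- coefficients d then witness that the glued vector v is primitive.
  choose c hc using fun p => (hw p).1
  choose v hv using fun i => exists_zmodProj_eq fun p => w p i
  choose d hd using fun i => exists_zmodProj_eq fun p => c p i
  have hvw (p) : zmodProj p ∘ v = w p := funext fun i => hv i p
  have hcoord : IsCoord W v := by
    refine ⟨⟨d, EllKorselt.ext_zmodProj fun p => ?_⟩, ?_⟩
    · simp only [map_add, map_mul, map_one, hv, hd, hc]
    · rw [equation_iff]
      refine EllKorselt.ext_zmodProj fun p => ?_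
      have := (hw p).2
      rw [← hW p, ← hvw p, equation_iff] at this
      simpa using this
  refine ⟨RPoint.mk v hcoord, fun p => ?_⟩
  rw [hQ p, RPoint.map_mk, RPoint.mk_eq_mk_iff, hvw p]
  exact parallel_refl _

/-- The projections to the factors are homomorphisms, each is surjective on points, and together
they separate points. Surjectivity carries annihilation by N from `W` to every factor, and
separation carries it back. -/
theorem zsmul_eq_zero_iff_forall_primeFactors [W.IsElliptic] [∀ p, (W' p).IsElliptic]
    [∀ p : n.primeFactors, NeZero ((p : ℕ) ^ n.factorization p)]
    (hW : ∀ p, W.map (zmodProj p) = W' p) (N : ℤ) :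
    (∀ P : RPoint W, N • P = 0) ↔ ∀ p, ∀ Q : RPoint (W' p), N • Q = 0 := by
  refine ⟨fun h p Q => ?_, fun h P => RPoint.ext_zmodProj hW fun p => ?_⟩
  · classical
    -- The value of the family away from p is immaterial; the origin is a convenient choice.
    obtain ⟨P, hP⟩ := RPoint.exists_map_zmodProj_eq hW (Function.update (fun _ => 0) p Q)
    have hPQ : RPoint.mapHom _ (hW p) P = Q := (hP p).trans (Function.update_self ..)
    rw [← hPQ, ← map_zsmul, h P, _root_.map_zero]
  · rw [RPoint.map_zero]
    -- `RPoint.map` is the function underlying `RPoint.mapHom`, which makes compatibility with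
    -- multiples available.
    change RPoint.mapHom _ (hW p) _ = 0
    rw [map_zsmul, h p]

end CRT

/-! ### Annihilators, exponents and the Korselt criterion -/

/-- The annihilator of `E(ℤ/nℤ)` is the intersection of those of its factors `E(ℤ/p^kℤ)`. -/
theorem zsmul_pointsMod_eq_zero_iff {E : WeierstrassCurve ℚ} {n : ℕ} [NeZero n]
    (good : ∀ p : ℕ, p.Prime → p ∣ n → HasGoodReductionAt E p) (N : ℤ) :
    haveI := isElliptic_reductionMod good
    (∀ P : PointsMod E n, N • P = 0) ↔
      ∀ (p : ℕ) (hp : p.Prime) (hpn : p ∣ n), (localExponent E n hp (good p hp hpn) : ℤ) ∣ N := by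
  have := isElliptic_reductionMod good
  have hp (p : n.primeFactors) := Nat.prime_of_mem_primeFactors p.2
  have hpn (p : n.primeFactors) := Nat.dvd_of_mem_primeFactors p.2
  have (p : n.primeFactors) : NeZero ((p : ℕ) ^ n.factorization p) := ⟨pow_ne_zero _ (hp p).ne_zero⟩
  have (p : n.primeFactors) : (reductionMod E (p ^ n.factorization p)).IsElliptic :=
    isElliptic_reductionMod_pow (hp p) (good p (hp p) (hpn p)) _
  -- The factor curves are the reductions of the minimal model modulo p^k itself; `map_int`
  -- identifies them with its reductions modulo n followed by projection.
  refine (zsmul_eq_zero_iff_forall_primeFactors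
    (fun p => map_int (minimalModel E) (zmodProj p)) N).trans ⟨fun h p hp hpn => ?_, fun h p => ?_⟩
  -- These instances are the ones hidden in `localExponent`. Being propositions, they agree with any
  -- other proofs, so the group structures match.
  · have : NeZero (p ^ n.factorization p) := ⟨pow_ne_zero _ hp.ne_zero⟩
    have := isElliptic_reductionMod_pow hp (good p hp hpn) (n.factorization p)
    exact AddGroup.exponent_dvd_iff_forall_zsmul_eq_zero.mpr
      (h ⟨p, Nat.mem_primeFactors.mpr ⟨hp, hpn, NeZero.ne n⟩⟩)
  · exact AddGroup.exponent_dvd_iff_forall_zsmul_eq_zero.mp (h p (hp p) (hpn p))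

end EllKorselt

theorem mainTheorem2 (E : WeierstrassCurve ℚ) [E.IsElliptic] (n : ℕ) (hn : 2 < n) (hodd : Odd n) :
    EllKorselt.IsEllipticCarmichael E n ↔ EllKorselt.IsEllipticKorseltII E n := by
  have : NeZero n := ⟨by lia⟩
  constructor
  · intro h
    -- The conditions on n that do not involve a point are part of being a pseudoprime for each P.
    -- The origin, a point of any reduction, serves to extract them.
    have h0 := h 0
    exact ⟨h0.two_le_card, h0.good, (EllKorselt.zsmul_pointsMod_eq_zero_iff h0.good _).mp
      fun P => (h P).smul_eq_zero⟩
  · intro h P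
    exact ⟨h.two_le_card, h.good,
      (EllKorselt.zsmul_pointsMod_eq_zero_iff h.good _).mpr h.exponent_dvd P⟩
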